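/- Let $X$ be a non-empty set and $\theta\in\mathscr{T}_X$ a transformation of $X$. Maps are written on the right and composed from left to right, $\pi_a$ denotes the kernel of $a\in\mathscr{T}_X$, and $Reg(\mathscr{T}_X^\theta)$ is the set of $a\in\mathscr{T}_X$ such that $a\theta b\theta a=a$ for some $b\in\mathscr{T}_X$. Let $\mathscr{P}_\theta$ be the category whose objects are the non-empty subsets $A\subseteq X$ that $\pi_\theta$ separates (each $\pi_\theta$-class contains at most one element of $A$), with all mappings as morphisms. Let $\Pi_\theta$ be the category whose objects are the $\bar\pi$ for the partitions $\pi$ of $X$ that $\mathrm{Im}\,\theta$ saturates (each $\pi$-class meets $\mathrm{Im}\,\theta$), where $\bar\pi$ is the set of mappings from $\pi$ to $X$; the morphisms $\bar\pi_1\to\bar\pi_2$ are the mappings $\eta^*\colon\alpha\mapsto\eta\alpha$ for $\eta\colon\pi_2\to\pi_1$. Write $\bar\pi\subseteq\bar\sigma$ if $\sigma$ refines $\pi$, and let $\theta^*(\bar\pi)$ be the object belonging to the partition $(\pi)\theta^{-1}$, in which $x,y$ are equivalent iff $x\theta,y\theta$ are $\pi$-equivalent. The bifunctors $\Gamma_\theta(-,-),\Delta_\theta(-,-)\colon\mathscr{P}_\theta\times\Pi_\theta\to\mathbf{Set}$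 are given on objects by $$\Gamma_\theta(A,\bar\pi)=\{a\in\mathscr{T}_X:\mathrm{Im}\,a\subseteq A,\ \bar\pi_a\subseteq\theta^*(\bar\pi)\},\qquad \Delta_\theta(A,\bar\pi)=\{a\in\mathscr{T}_X:\mathrm{Im}\,a\subseteq A\theta,\ \bar\pi_a\subseteq\bar\pi\},$$ and on a morphism $(f,\eta^*)\colon(A,\bar\pi_1)\to(B,\bar\pi_2)$ by $$\Gamma_\theta(f,\eta^*)\colon a\mapsto\theta\,\eta\,(\theta_{|C})^{-1}a f,\qquad \Delta_\theta(f,\eta^*)\colon a\mapsto\eta\, a\,(\theta_{|A})^{-1}f\theta,$$ where $C$ is a cross-section of $(\pi_1)\theta^{-1}$; here $\eta$ is regarded as a mapping that sends each point of $X$ to the $\pi_1$-class which is the $\eta$-image of its $\pi_2$-class, in $\Gamma_\theta(f,\eta^*)$ each $\pi_1$-class is identified with its representative in the cross-section $C\theta$ of $\pi_1$, and in $\Delta_\theta(f,\eta^*)$ the map $a$, being constant on $\pi_1$-classes, is applied to classes. Then the rule $\theta a\mapsto a\theta$ defines a natural isomorphism $\chi$ from $\Gamma_\theta(-,-)$ to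 $\Delta_\theta(-,-)$. Precisely: let $(A,\bar\pi)\in v\mathscr{P}_\theta\times v\Pi_\theta$. 1. If $a\in Reg(\mathscr{T}_X^\theta)$ satisfies $\mathrm{Im}\,a\subseteq A$ and $\bar\pi_a\subseteq\bar\pi$, then $\theta a\in\Gamma_\theta(A,\bar\pi)$ and $a\theta\in\Delta_\theta(A,\bar\pi)$. 2. Every element of $\Gamma_\theta(A,\bar\pi)$ is $\theta a$ for exactly one such $a$. 3. There is a natural isomorphism $\chi\colon\Gamma_\theta(-,-)\to\Delta_\theta(-,-)$ such that $\chi(A,\bar\pi)(\theta a)=a\theta$ for all $(A,\bar\pi)$ and all such $a$. Moreover, for every $a\in Reg(\mathscr{T}_X^\theta)$ the element $\theta a$ is linked to $a\theta$: there is $(A,\bar\pi)\in v\mathscr{P}_\theta\times v\Pi_\theta$ with $\theta a\in\Gamma_\theta(A,\bar\pi)$ and $\chi(A,\bar\pi)(\theta a)=a\theta$. -/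

import Mathlib

open CategoryTheory

universe u

namespace Variant

/-- The product `a b` of two transformations, written from left to right: first `a`, then `b`.
This is the multiplication of the full transformation semigroup `𝒯_X`. -/
def seq {X : Type u} (a b : X → X) : X → X := fun x => b (a x)

/-- The underlying set of the variant `𝒯_X^θ`. -/
def VariantSemigroup {X : Type u} (_θ : X → X) : Type u := X → X

/-- The variant `𝒯_X^θ`, with product `a ∗ b = a θ b`. -/
instance {X : Type u} (θ : X → X) : Semigroup (VariantSemigroup θ) where
  mul a b := seq (seq a θ) b
  mul_assoc _ _ _ := rfl

/-- `Reg(𝒯_X^θ)`: the (von Neumann) regular elements of the variant, as transformations of `X`. -/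
def Reg {X : Type u} (θ : X → X) : Set (X → X) :=
  {a : VariantSemigroup θ | ∃ b : VariantSemigroup θ, a * b * a = a}

/-- `A` saturates `π`: every `π`-class contains at least one element of `A`. -/
def Saturates {X : Type u} (A : Set X) (π : Setoid X) : Prop :=
  ∀ q : Quotient π, ∃ x ∈ A, Quotient.mk π x = q

/-- `π` separates `A`: every `π`-class contains at most one element of `A`. -/
def Separates {X : Type u} (π : Setoid X) (A : Set X) : Prop :=
  ∀ x ∈ A, ∀ y ∈ A, π x y → x = y

/-- `A` is a cross-section of `π`: every `π`-class contains exactly one element of `A`. -/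
def IsCrossSection {X : Type u} (A : Set X) (π : Setoid X) : Prop :=
  Saturates A π ∧ Separates π A

/-! ### The powerset category `𝒫(X)` and its full subcategory `𝒫_θ` -/

/-- Objects of `𝒫(X)`: the non-empty subsets of `X`. -/
structure PowerCat (X : Type u) where
  carrier : Set X
  nonempty : carrier.Nonempty

/-- Morphisms of `𝒫(X)`: arbitrary mappings. -/
@[ext]
structure PowerCat.Hom {X : Type u} (A B : PowerCat X) where
  toFun : A.carrier → B.carrier

instance (X : Type u) : Category.{u} (PowerCat X) where
  Hom A B := PowerCat.Hom A B
  id A := ⟨fun x => x⟩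
  comp f g := ⟨fun x => g.toFun (f.toFun x)⟩

/-- `𝒫_θ`: the full subcategory of `𝒫(X)` on the sets `A` that `π_θ = ker θ` separates. -/
abbrev PTheta {X : Type u} (θ : X → X) :=
  ObjectProperty.FullSubcategory
    (fun A : PowerCat X => Separates (Setoid.ker θ) A.carrier)

/-! ### The partition category `Π(X)` and its full subcategory `Π_θ` -/

/-- Objects of `Π(X)`: the partitions of `X`, that is, the equivalence relations on `X`.
(`PartCat.mk π` stands for `π̄`.) -/
structure PartCat (X : Type u) where
  rel : Setoid X

/-- The set of blocks of a partition. -/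
abbrev PartCat.Blocks {X : Type u} (π : PartCat X) : Type u := Quotient π.rel

/-- A morphism `η^* : π̄₁ → π̄₂` of `Π(X)` is given by a mapping `η` from the set of blocks of `π₂`
to the set of blocks of `π₁`. -/
@[ext]
structure PartCat.Hom {X : Type u} (π₁ π₂ : PartCat X) where
  eta : π₂.Blocks → π₁.Blocks

instance (X : Type u) : Category.{u} (PartCat X) where
  Hom π₁ π₂ := PartCat.Hom π₁ π₂
  id π := ⟨fun q => q⟩
  comp f g := ⟨fun q => f.eta (g.eta q)⟩

/-- `π̄` as the set of all mappings from `π` to `X`, and `η^*` as the mapping `α ↦ η α` from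
`π̄₁` to `π̄₂`. -/
def PartCat.bar (X : Type u) : PartCat X ⥤ Type u where
  obj π := π.Blocks → X
  map f := TypeCat.ofHom fun α q => α (f.eta q)

/-- The mapping `η^*` determines `η`, so that describing morphisms by `η` is harmless. -/
instance (X : Type u) : (PartCat.bar X).Faithful where
  map_injective {π₁ π₂} f g h := by
    apply PartCat.Hom.ext
    funext q
    by_contra hne
    obtain ⟨x, hx⟩ := Quotient.exists_rep (f.eta q)
    obtain ⟨y, hy⟩ := Quotient.exists_rep (g.eta q)
    have hxy : x ≠ y := by
      rintro rfl
      exact hne (hx.symm.trans hy)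
    classical
    have key : ∀ α : π₁.Blocks → X, α (f.eta q) = α (g.eta q) := fun α =>
      congrFun (ConcreteCategory.congr_hom h α) q
    have := key (fun p => if p = f.eta q then x else y)
    rw [if_pos rfl, if_neg (fun h => hne h.symm)] at this
    exact hxy this

/-- `Π_θ`: the full subcategory of `Π(X)` on the partitions that `Im θ` saturates. -/
abbrev PiTheta {X : Type u} (θ : X → X) :=
  ObjectProperty.FullSubcategory
    (fun π : PartCat X => Saturates (Set.range θ) π.rel)

/-- The inclusion `π̄ ⊆ σ̄`: every mapping of `X` that is constant on the blocks of `π` is constant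
on the blocks of `σ`, that is, `σ` refines `π`. -/
def BarLE {X : Type u} (π σ : Setoid X) : Prop := σ ≤ π

/-! ### The bifunctor `Γ_θ(-,-)` -/

section Gamma

variable {X : Type u} {θ : X → X}

/-- `Γ_θ(A, π̄) = {a : Im a ⊆ A and π̄_a ⊆ θ^*(π̄)}`, where `θ^*(π̄)` is the object that belongs
to the partition `(π)θ⁻¹`, in which `x` and `y` are equivalent iff `xθ` and `yθ` are `π`-equivalent. -/
def GammaSet (A : PTheta θ) (π : PiTheta θ) : Set (X → X) :=
  {a | Set.range a ⊆ A.obj.carrier ∧ BarLE (Setoid.ker a) (Setoid.comap θ π.obj.rel)}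

/-- A choice of one point in the `θ`-preimage of each block of `π`. Its range is a cross-section `C`
of `(π)θ⁻¹`, and the mapping itself is `(θ_{|C})⁻¹`, when the cross-section `Cθ` of `π` is
identified with the set of blocks of `π`. -/
noncomputable def sec (π : PiTheta θ) (q : π.obj.Blocks) : X :=
  (show ∃ x, Quotient.mk π.obj.rel (θ x) = q by
    obtain ⟨_, ⟨x, rfl⟩, hx⟩ := π.property q
    exact ⟨x, hx⟩).choose

theorem sec_spec (π : PiTheta θ) (q : π.obj.Blocks) :
    Quotient.mk π.obj.rel (θ (sec π q)) = q :=
  (show ∃ x, Quotient.mk π.obj.rel (θ x) = q by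
    obtain ⟨_, ⟨x, rfl⟩, hx⟩ := π.property q
    exact ⟨x, hx⟩).choose_spec

theorem isCrossSection_range_sec (π : PiTheta θ) :
    IsCrossSection (Set.range (sec π)) (Setoid.comap θ π.obj.rel) := by
  constructor
  · intro q
    induction q using Quotient.inductionOn with
    | _ x =>
      refine ⟨_, ⟨Quotient.mk _ (θ x), rfl⟩, Quotient.sound ?_⟩
      exact Quotient.exact (s := π.obj.rel) (sec_spec π (Quotient.mk _ (θ x)))
  · rintro _ ⟨p, rfl⟩ _ ⟨q, rfl⟩ h
    have h' : Quotient.mk π.obj.rel (θ (sec π p)) = Quotient.mk π.obj.rel (θ (sec π q)) :=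
      Quotient.sound h
    rw [sec_spec, sec_spec] at h'
    rw [h']

theorem separates_range_sec (π : PiTheta θ) :
    Separates (Setoid.ker θ) (Set.range (sec π)) := by
  intro x hx y hy h
  refine (isCrossSection_range_sec π).2 x hx y hy ?_
  have h' : θ x = θ y := h
  change π.obj.rel (θ x) (θ y)
  rw [h']

/-- The transformation `θ η (θ_{|C})⁻¹ a f`. -/
noncomputable def gammaFun {A B : PTheta θ} {π₁ π₂ : PiTheta θ} (f : A ⟶ B) (η : π₁ ⟶ π₂)
    (a : X → X) (ha : a ∈ GammaSet A π₁) : X → X := fun x =>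
  f.hom.toFun ⟨a (sec π₁ (η.hom.eta (Quotient.mk _ (θ x)))), ha.1 ⟨_, rfl⟩⟩

/-- `gammaFun` does not depend on the cross-section `C`. -/
theorem gammaFun_eq {A B : PTheta θ} {π₁ π₂ : PiTheta θ} (f : A ⟶ B) (η : π₁ ⟶ π₂)
    (a : X → X) (ha : a ∈ GammaSet A π₁) (x c : X)
    (hc : Quotient.mk _ (θ c) = η.hom.eta (Quotient.mk _ (θ x))) :
    gammaFun f η a ha x = f.hom.toFun ⟨a c, ha.1 ⟨_, rfl⟩⟩ := by
  have h : a (sec π₁ (η.hom.eta (Quotient.mk _ (θ x)))) = a c :=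
    ha.2 (Quotient.exact (s := π₁.obj.rel) ((sec_spec π₁ _).trans hc.symm))
  unfold gammaFun
  congr 2
  exact Subtype.ext h

theorem gammaFun_mem {A B : PTheta θ} {π₁ π₂ : PiTheta θ} (f : A ⟶ B) (η : π₁ ⟶ π₂)
    (a : X → X) (ha : a ∈ GammaSet A π₁) : gammaFun f η a ha ∈ GammaSet B π₂ := by
  constructor
  · rintro _ ⟨x, rfl⟩
    exact Subtype.property _
  · intro x y h
    have h' : Quotient.mk π₂.obj.rel (θ x) = Quotient.mk π₂.obj.rel (θ y) := Quotient.sound h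
    change gammaFun f η a ha x = gammaFun f η a ha y
    simp only [gammaFun, h']

/-- The bifunctor `Γ_θ(-,-) : 𝒫_θ × Π_θ → Set`. -/
noncomputable def GammaBi (θ : X → X) : PTheta θ × PiTheta θ ⥤ Type u where
  obj p := GammaSet p.1 p.2
  map {p q} g := TypeCat.ofHom fun a : GammaSet p.1 p.2 =>
    (⟨gammaFun g.1 g.2 a.1 a.2, gammaFun_mem g.1 g.2 a.1 a.2⟩ : GammaSet q.1 q.2)
  map_id p := by
    apply ConcreteCategory.hom_ext
    intro a
    refine Subtype.ext (funext fun x => ?_)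
    exact gammaFun_eq (𝟙 p.1) (𝟙 p.2) a.1 a.2 x x rfl
  map_comp {p q r} g h := by
    apply ConcreteCategory.hom_ext
    intro a
    refine Subtype.ext (funext fun x => ?_)
    refine gammaFun_eq (g.1 ≫ h.1) (g.2 ≫ h.2) a.1 a.2 x
      (sec p.2 (g.2.hom.eta (Quotient.mk _ (θ (sec q.2 (h.2.hom.eta (Quotient.mk _ (θ x)))))))) ?_
    rw [sec_spec, sec_spec]
    rfl

end Gamma

/-! ### The bifunctor `Δ_θ(-,-)` -/

section Delta

variable {X : Type u} {θ : X → X}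

/-- `Δ_θ(A, π̄) = {a : Im a ⊆ Aθ and π̄_a ⊆ π̄}`. -/
def DeltaSet (A : PTheta θ) (π : PiTheta θ) : Set (X → X) :=
  {a | Set.range a ⊆ θ '' A.obj.carrier ∧ BarLE (Setoid.ker a) π.obj.rel}

/-- The inverse `(θ_{|A})⁻¹ : Aθ → A` of the bijection `θ_{|A} : A → Aθ`. -/
noncomputable def invOn (A : PTheta θ) (y : θ '' A.obj.carrier) : A.obj.carrier :=
  ⟨y.2.choose, y.2.choose_spec.1⟩

theorem invOn_spec (A : PTheta θ) (y : θ '' A.obj.carrier) : θ (invOn A y) = y :=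
  y.2.choose_spec.2

theorem invOn_eq (A : PTheta θ) (y : θ '' A.obj.carrier) (u : A.obj.carrier)
    (h : θ u = y) : invOn A y = u :=
  Subtype.ext (A.property _ (invOn A y).2 _ u.2 ((invOn_spec A y).trans h.symm))

/-- An element `a` of `Δ_θ(A, π̄)` as a mapping from the set of blocks of `π` to `Aθ`. -/
def onBlocks {A : PTheta θ} {π : PiTheta θ} (a : X → X) (ha : a ∈ DeltaSet A π)
    (q : π.obj.Blocks) : θ '' A.obj.carrier :=
  Quotient.lift (fun x => (⟨a x, ha.1 ⟨x, rfl⟩⟩ : θ '' A.obj.carrier))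
    (fun _ _ h => Subtype.ext (ha.2 h)) q

/-- The transformation `η a (θ_{|A})⁻¹ f θ`. -/
noncomputable def deltaFun {A B : PTheta θ} {π₁ π₂ : PiTheta θ} (f : A ⟶ B) (η : π₁ ⟶ π₂)
    (a : X → X) (ha : a ∈ DeltaSet A π₁) : X → X := fun x =>
  θ (f.hom.toFun (invOn A (onBlocks a ha (η.hom.eta (Quotient.mk _ x)))))

theorem deltaFun_eq {A B : PTheta θ} {π₁ π₂ : PiTheta θ} (f : A ⟶ B) (η : π₁ ⟶ π₂)
    (a : X → X) (ha : a ∈ DeltaSet A π₁) (x c : X) (u : A.obj.carrier)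
    (hc : Quotient.mk _ c = η.hom.eta (Quotient.mk _ x)) (hu : θ u = a c) :
    deltaFun f η a ha x = θ (f.hom.toFun u) := by
  unfold deltaFun
  rw [← hc, invOn_eq A _ u hu]

theorem deltaFun_mem {A B : PTheta θ} {π₁ π₂ : PiTheta θ} (f : A ⟶ B) (η : π₁ ⟶ π₂)
    (a : X → X) (ha : a ∈ DeltaSet A π₁) : deltaFun f η a ha ∈ DeltaSet B π₂ := by
  constructor
  · rintro _ ⟨x, rfl⟩
    exact ⟨_, Subtype.property _, rfl⟩
  · intro x y h
    have h' : Quotient.mk π₂.obj.rel x = Quotient.mk π₂.obj.rel y := Quotient.sound h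
    change deltaFun f η a ha x = deltaFun f η a ha y
    simp only [deltaFun, h']

/-- The bifunctor `Δ_θ(-,-) : 𝒫_θ × Π_θ → Set`. -/
noncomputable def DeltaBi (θ : X → X) : PTheta θ × PiTheta θ ⥤ Type u where
  obj p := DeltaSet p.1 p.2
  map {p q} g := TypeCat.ofHom fun a : DeltaSet p.1 p.2 =>
    (⟨deltaFun g.1 g.2 a.1 a.2, deltaFun_mem g.1 g.2 a.1 a.2⟩ : DeltaSet q.1 q.2)
  map_id p := by
    apply ConcreteCategory.hom_ext
    intro a
    refine Subtype.ext (funext fun x => ?_)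
    have hx := invOn_spec p.1 ⟨a.1 x, a.2.1 ⟨x, rfl⟩⟩
    exact (deltaFun_eq (𝟙 p.1) (𝟙 p.2) a.1 a.2 x x _ rfl hx).trans hx
  map_comp {p q r} g h := by
    apply ConcreteCategory.hom_ext
    intro a
    refine Subtype.ext (funext fun x => ?_)
    obtain ⟨y, hy⟩ := Quotient.exists_rep (h.2.hom.eta (Quotient.mk _ x))
    obtain ⟨z, hz⟩ := Quotient.exists_rep (g.2.hom.eta (Quotient.mk _ y))
    have hu := invOn_spec p.1 ⟨a.1 z, a.2.1 ⟨z, rfl⟩⟩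
    have h1 := deltaFun_eq g.1 g.2 a.1 a.2 y z _ hz hu
    have h2 := deltaFun_eq h.1 h.2 _ (deltaFun_mem g.1 g.2 a.1 a.2) x y _ hy h1.symm
    have h3 := deltaFun_eq (g.1 ≫ h.1) (g.2 ≫ h.2) a.1 a.2 x z _
      (hz.trans (congrArg g.2.hom.eta hy)) hu
    exact h3.trans h2.symm

end Delta

/-- The component `χ(A, π̄) : Γ_θ(A, π̄) → Δ_θ(A, π̄)` of a natural isomorphism `χ`, as a mapping. -/
def component {X : Type u} {θ : X → X} (χ : GammaBi θ ≅ DeltaBi θ) (A : PTheta θ)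
    (π : PiTheta θ) : GammaSet A π → DeltaSet A π :=
  fun γ => χ.hom.app (A, π) γ

/-- With respect to a natural isomorphism `χ` between `Γ_θ(-,-)` and `Δ_θ(-,-)`, the transformation
`γ` is linked to `δ` if there is `(A, π̄)` with `γ ∈ Γ_θ(A, π̄)` and `δ = χ(A, π̄)(γ)`. -/
def Linked {X : Type u} {θ : X → X} (χ : GammaBi θ ≅ DeltaBi θ) (γ δ : X → X) : Prop :=
  ∃ (A : PTheta θ) (π : PiTheta θ) (hγ : γ ∈ GammaSet A π),
    (component χ A π ⟨γ, hγ⟩ : X → X) = δ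

end Variant

namespace Variant

variable {X : Type u} {θ : X → X}

/-! Both `GammaSet A π` and `DeltaSet A π` are copies of the set of mappings from the blocks of `π`
to `A`. Since `Im θ` meets every block, the classes of `(π)θ⁻¹` correspond to the blocks of `π`, so
each `γ` is `θ a` for a single `a` constant on blocks, namely `extendGamma π γ`. Since `θ` is
injective on `A`, such an `a` with values in `A` is also recovered from `a θ`. In these terms both
bifunctors send `a` to `η a f`, whence naturality. The same two conditions on `A` and `π` make `a`
regular (`extendGamma_mem_Reg`); conversely, regularity of `a` gives them for `A = Im a` and `π =
ker a`, whence the linking. -/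

theorem mem_Reg_iff {a : X → X} :
    a ∈ Reg θ ↔ ∃ b : X → X, ∀ x, a (θ (b (θ (a x)))) = a x :=
  ⟨fun ⟨b, hb⟩ => ⟨b, fun x => congrFun hb x⟩, fun ⟨b, hb⟩ => ⟨b, funext hb⟩⟩

/-- The identity `a θ b θ a = a` recovers `a x` from `θ (a x)`, so `θ` is injective on `Im a`. -/
theorem separates_range_of_mem_Reg {a : X → X} (ha : a ∈ Reg θ) :
    Separates (Setoid.ker θ) (Set.range a) := by
  obtain ⟨b, hb⟩ := mem_Reg_iff.1 ha
  rintro _ ⟨x, rfl⟩ _ ⟨y, rfl⟩ h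
  have h' : θ (a x) = θ (a y) := h
  rw [← hb x, h', hb y]

theorem saturates_ker_of_mem_Reg {a : X → X} (ha : a ∈ Reg θ) :
    Saturates (Set.range θ) (Setoid.ker a) := by
  obtain ⟨b, hb⟩ := mem_Reg_iff.1 ha
  intro q
  induction q using Quotient.inductionOn with
  -- The same identity puts `θ (b (θ (a x)))`, a point of `Im θ`, in the class of `x`.
  | _ x => exact ⟨_, ⟨b (θ (a x)), rfl⟩, Quotient.sound (hb x)⟩

theorem seq_mem_GammaSet {A : PTheta θ} {π : PiTheta θ} {a : X → X}
    (hA : Set.range a ⊆ A.obj.carrier) (hπ : BarLE (Setoid.ker a) π.obj.rel) :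
    seq θ a ∈ GammaSet A π := by
  refine ⟨?_, fun x y h => hπ h⟩
  rintro _ ⟨x, rfl⟩
  exact hA ⟨θ x, rfl⟩

theorem seq_mem_DeltaSet {A : PTheta θ} {π : PiTheta θ} {a : X → X}
    (hA : Set.range a ⊆ A.obj.carrier) (hπ : BarLE (Setoid.ker a) π.obj.rel) :
    seq a θ ∈ DeltaSet A π := by
  refine ⟨?_, fun x y h => congrArg θ (hπ h)⟩
  rintro _ ⟨x, rfl⟩
  exact ⟨a x, hA ⟨x, rfl⟩, rfl⟩

/-- Elements of `Γ_θ(A, π̄)` are determined on a class of `(π)θ⁻¹` by any of its points. -/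
theorem apply_sec_of_mem_GammaSet {A : PTheta θ} {π : PiTheta θ} {γ : X → X} (hγ : γ ∈ GammaSet A π)
    {q : π.obj.Blocks} {c : X} (hc : Quotient.mk _ (θ c) = q) : γ (sec π q) = γ c :=
  hγ.2 (Quotient.exact (s := π.obj.rel) ((sec_spec π q).trans hc.symm))

/-- The transformation `a` with `θ a = γ`, constant on the blocks of `π`. -/
noncomputable def extendGamma (π : PiTheta θ) (γ : X → X) : X → X := fun x =>
  γ (sec π (Quotient.mk _ x))

theorem range_extendGamma {A : PTheta θ} {π : PiTheta θ} {γ : X → X} (hγ : γ ∈ GammaSet A π) :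
    Set.range (extendGamma π γ) ⊆ A.obj.carrier := by
  rintro _ ⟨x, rfl⟩
  exact hγ.1 ⟨_, rfl⟩

theorem barLE_ker_extendGamma (π : PiTheta θ) (γ : X → X) :
    BarLE (Setoid.ker (extendGamma π γ)) π.obj.rel := fun x y h => by
  have h' : Quotient.mk π.obj.rel x = Quotient.mk π.obj.rel y := Quotient.sound h
  change extendGamma π γ x = extendGamma π γ y
  simp only [extendGamma, h']

theorem seq_extendGamma {A : PTheta θ} {π : PiTheta θ} {γ : X → X} (hγ : γ ∈ GammaSet A π) :
    seq θ (extendGamma π γ) = γ :=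
  funext fun _ => apply_sec_of_mem_GammaSet hγ rfl

theorem extendGamma_mem_Reg {A : PTheta θ} {π : PiTheta θ} {γ : X → X}
    (hγ : γ ∈ GammaSet A π) : extendGamma π γ ∈ Reg θ := by
  classical
  rw [mem_Reg_iff]
  have hex : ∀ x, ∃ z, θ (extendGamma π γ z) = θ (extendGamma π γ x) := fun x => ⟨x, rfl⟩
  -- The inner inverse picks `z` over `y` and returns a point that `θ` sends into the block of `z`;
  -- its value off the image of `a θ` is irrelevant.
  refine ⟨fun y => if h : ∃ z, θ (extendGamma π γ z) = y
    then sec π (Quotient.mk _ h.choose) else y, fun x => ?_⟩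
  have hA := range_extendGamma hγ
  beta_reduce
  rw [dif_pos (hex x)]
  refine (congrFun (seq_extendGamma hγ) _).trans ?_
  -- The values at `z` and `x` lie in `A` and agree after `θ`, hence coincide.
  exact A.property _ (hA ⟨_, rfl⟩) _ (hA ⟨_, rfl⟩) (hex x).choose_spec

/-- Every block contains a point of `Im θ`, where `θ a` already shows the value of `a` on that
block. -/
theorem eq_extendGamma {π : PiTheta θ} {a : X → X} (hπ : BarLE (Setoid.ker a) π.obj.rel) :
    extendGamma π (seq θ a) = a :=
  funext fun x => hπ (Quotient.exact (s := π.obj.rel) (sec_spec π (Quotient.mk _ x)))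

/-- The bijection `θ a ↦ a θ` from `Γ_θ(A, π̄)` to `Δ_θ(A, π̄)`. -/
noncomputable def gammaEquivDelta (A : PTheta θ) (π : PiTheta θ) :
    GammaSet A π ≃ DeltaSet A π where
  toFun γ := ⟨seq (extendGamma π γ.1) θ,
    seq_mem_DeltaSet (range_extendGamma γ.2) (barLE_ker_extendGamma π γ.1)⟩
  -- Lifting `δ` through `θ` restricted to `A` gives back `a`; composing with `θ` first gives `θ a`.
  invFun δ := ⟨fun x => invOn A (onBlocks δ.1 δ.2 (Quotient.mk _ (θ x))), by
    refine ⟨?_, fun x y h => ?_⟩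
    · rintro _ ⟨x, rfl⟩
      exact Subtype.property _
    · have h' : Quotient.mk π.obj.rel (θ x) = Quotient.mk π.obj.rel (θ y) := Quotient.sound h
      exact congrArg (fun q => (invOn A (onBlocks δ.1 δ.2 q) : X)) h'⟩
  left_inv γ := by
    refine Subtype.ext (funext fun x => ?_)
    exact congrArg Subtype.val (invOn_eq A _ ⟨γ.1 x, γ.2.1 ⟨x, rfl⟩⟩
      (congrArg θ (apply_sec_of_mem_GammaSet γ.2 rfl).symm))
  right_inv δ := by
    refine Subtype.ext (funext fun x => ?_)
    refine (invOn_spec A _).trans ?_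
    rw [sec_spec]
    rfl

/-- The natural isomorphism `χ` given by `θ a ↦ a θ`. -/
noncomputable def gammaIsoDelta (θ : X → X) : GammaBi θ ≅ DeltaBi θ :=
  NatIso.ofComponents (fun p => (gammaEquivDelta p.1 p.2).toIso) (by
    intro p q g
    apply ConcreteCategory.hom_ext
    intro γ
    refine Subtype.ext (funext fun x => ?_)
    -- With `c` in the block `η` assigns to that of `x`, and `a = extendGamma p.2 γ.1`, both paths
    -- of the square give `θ (f (a c))` at `x`.
    obtain ⟨c, hc⟩ := Quotient.exists_rep (g.2.hom.eta (Quotient.mk _ x))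
    refine Eq.trans (congrArg θ (gammaFun_eq g.1 g.2 γ.1 γ.2
      (sec q.2 (Quotient.mk _ x)) (sec p.2 (Quotient.mk _ c)) ?_)) ?_
    · rw [sec_spec, sec_spec]
      exact hc
    · exact (deltaFun_eq g.1 g.2 _ (gammaEquivDelta p.1 p.2 γ).2 x c
        ⟨extendGamma p.2 γ.1 c, range_extendGamma γ.2 ⟨c, rfl⟩⟩ hc rfl).symm)

theorem component_gammaIsoDelta (A : PTheta θ) (π : PiTheta θ) (a : X → X)
    (hγ : seq θ a ∈ GammaSet A π) (hπ : BarLE (Setoid.ker a) π.obj.rel) :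
    (component (gammaIsoDelta θ) A π ⟨seq θ a, hγ⟩ : X → X) = seq a θ :=
  congrArg (fun b => seq b θ) (eq_extendGamma hπ)

end Variant

theorem mainTheorem4 {X : Type u} [Nonempty X] (θ : X → X) :
    (∀ (A : Variant.PTheta θ) (π : Variant.PiTheta θ),
      (∀ a ∈ Variant.Reg θ, Set.range a ⊆ A.obj.carrier →
        Variant.BarLE (Setoid.ker a) π.obj.rel →
          Variant.seq θ a ∈ Variant.GammaSet A π ∧ Variant.seq a θ ∈ Variant.DeltaSet A π) ∧
      (∀ γ ∈ Variant.GammaSet A π, ∃! a : X → X, a ∈ Variant.Reg θ ∧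
        Set.range a ⊆ A.obj.carrier ∧ Variant.BarLE (Setoid.ker a) π.obj.rel ∧
          Variant.seq θ a = γ)) ∧
    ∃ χ : Variant.GammaBi θ ≅ Variant.DeltaBi θ,
      (∀ (A : Variant.PTheta θ) (π : Variant.PiTheta θ) (a : X → X)
        (hγ : Variant.seq θ a ∈ Variant.GammaSet A π),
        a ∈ Variant.Reg θ → Set.range a ⊆ A.obj.carrier →
        Variant.BarLE (Setoid.ker a) π.obj.rel →
          (Variant.component χ A π ⟨Variant.seq θ a, hγ⟩ : X → X) = Variant.seq a θ) ∧
      (∀ a ∈ Variant.Reg θ, Variant.Linked χ (Variant.seq θ a) (Variant.seq a θ)) := by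
  refine ⟨fun A π => ⟨fun a _ hA hπ =>
      ⟨Variant.seq_mem_GammaSet hA hπ, Variant.seq_mem_DeltaSet hA hπ⟩, fun γ hγ => ?_⟩,
    Variant.gammaIsoDelta θ, fun A π a hγ _ _ hπ =>
      Variant.component_gammaIsoDelta A π a hγ hπ, fun a ha => ?_⟩
  · refine ⟨Variant.extendGamma π γ, ⟨Variant.extendGamma_mem_Reg hγ,
      Variant.range_extendGamma hγ, Variant.barLE_ker_extendGamma π γ,
      Variant.seq_extendGamma hγ⟩, ?_⟩
    rintro a ⟨_, _, hπ, rfl⟩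
    exact (Variant.eq_extendGamma hπ).symm
  · let A : Variant.PTheta θ :=
      ⟨⟨Set.range a, Set.range_nonempty a⟩, Variant.separates_range_of_mem_Reg ha⟩
    let π : Variant.PiTheta θ := ⟨⟨Setoid.ker a⟩, Variant.saturates_ker_of_mem_Reg ha⟩
    exact ⟨A, π, Variant.seq_mem_GammaSet subset_rfl le_rfl,
      Variant.component_gammaIsoDelta A π a _ le_rfl⟩
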